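/- Let $F$ be a CNF formula with at most three literals per clause over a finite set $V$ of variables whose unique satisfying assignment is all-ones. A critical clause of $a\in V$ is a clause of $F$ violated by the assignment that is $0$ at $a$ and $1$ elsewhere. For each $a$ fix one critical clause, the canonical one. Let $\mathrm{TwoCC}\subseteq V$ contain all variables that have two or more critical clauses. Let $H_{\rm low}$ be a graph on $V$ of maximum degree at most $2$, each of whose edges $\{b,c\}$ comes from some canonical critical clause $(a\vee\bar b\vee\bar c)$. Let $x\notin\mathrm{TwoCC}$ have canonical critical clause $(x\vee\bar y\vee\bar z)$, $y\ne z$, where $z$ is isolated in $H_{\rm low}$. Let $T_x$ be a critical clause tree of $x$ of height $h'$: the root has variable label $x$; a node $v$ of depth less than $h'$ with variable label $a$ has as clause label a clause of $F$ violated by $\alpha_v$, the assignment that is $0$ exactly at the variable labels on the path from the root to $v$, and this is the canonical critical clause of $a$ whenever $\alpha_v$ violates that; $v$ has one child with variable label $b$ for each negative literal $\bar b$ of its clause label; nodes of depth $h'$ are leaves. Let $L,R$ be the children of the root, labeled $y,z$. A node $v$ is canonical if every node $u$ on the path from the root to $v$ (both included) has depth less than $h'$, a variable label outside $\mathrm{TwoCC}$,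 and as clause label the canonical critical clause of its variable label. Write $d(v)$ for the depth of $v$. Let $B_1,B_z$ be disjoint sets of nodes in the subtree of $T_x$ rooted at $L$ such that $B_1\cup B_z$ is an antichain, all proper ancestors of nodes of $B_1\cup B_z$ are canonical, nodes of $B_z$ are labeled $z$, and nodes of $B_1$ are not labeled $z$, have depth less than $h'$ and have at most one child in $T_x$. Let $0\le\epsilon\le 1/10$ and $0\le r<1/2$. Put $\gamma(s)=s(1-2s)^{3/2}$ for $s<1/2$ and $\gamma(s)=0$ otherwise, $\phi=\gamma'$, and $$\delta_{\rm root}=\max(0,-1.147\,\epsilon\,\gamma(r)\phi(r)),\qquad \delta_{\text{non-root}}=1.147\,\epsilon\,\tfrac{\gamma(r)^2}{1-r},$$ $$\delta_{\max}=\max\Big(1.147\,\epsilon\,\tfrac{2\gamma(r)^2}{1-r},\ 1.147\,\epsilon\,\gamma(r)\big(\tfrac{\gamma(r)}{1-r}-\phi(r)\big)\Big),\qquad Q_r=\Big(\tfrac{r}{1-r}\Big)^2.$$ For a canonical node $v$ let $\delta_v$ be the sum, over all proper ancestors $u$ of $v$ whose variable label is adjacent in $H_{\rm low}$ to that of $v$,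 of $\delta_{\rm root}$ if $u$ is the root and of $\delta_{\text{non-root}}$ otherwise; for every other node $v$ (in $T_x$ or newly introduced) let $\delta_v=0$. Define $$\mathrm{OCB}(d,r)=\frac{r(1-2r)-2\delta_{\max}(1-r)}{(1-r)^2}\Big(r-\frac{\delta_{\max}}{1-r}\Big)^{d},\qquad \mathrm{MLB}(d,r)=(1-Q_r)^2\Big(r-\frac{\delta_{\max}}{1-r}\Big)^{d-1}r(1-r).$$ The fully cleaned-up tree $T''=\mathrm{CleanUp}(T_x,r)$ is the infinite binary tree obtained from $T_x$ by adding all missing children, with a distinct label at each node. The partially cleaned-up tree $T'$ has the same nodes, except that nodes of $B_1$ receive no children besides those they have in $T_x$; the nodes of $B_z\cup\{R\}$ all share the label $z$, and all other nodes have distinct labels. A random placement $\pi$ assigns independent real numbers to all labels, with $\Pr[\pi(z)<r]=r$ and $\Pr[\pi(l)<r]=r-\delta_v$ for the label $l$ of a node $v$ (other than the nodes of $T'$ labeled $z$), where in $T'$, for nodes $v$ in the subtrees rooted at nodes of $B_1$, one may more generally have any probability $\Pr[\pi(l)<r]\ge r-\delta_{\max}$. Let $\mathrm{Cut}_r(T)$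 be the event that every infinite path in $T$ starting at the root contains a non-root node whose label $l$ has $\pi(l)<r$. Then $$\Pr[\mathrm{Cut}_r(T')]\ \ge\ \Pr[\mathrm{Cut}_r(T'')]+\sum_{v\in B_1}\mathrm{OCB}(d(v),r)+\sum_{v\in B_z}\mathrm{MLB}(d(v),r).$$ -/

import Mathlib

open MeasureTheory ProbabilityTheory

namespace PPSZ

/-! ### Formulas and critical clauses -/

/-- A literal: `(a, true)` is the positive literal of `a`, `(a, false)` the negative one. -/
abbrev Literal (V : Type*) := V × Bool

abbrev Clause (V : Type*) := Finset (Literal V)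

abbrev CNF (V : Type*) := Finset (Clause V)

abbrev Assignment (V : Type*) := V → Bool

/-- Every literal of `C` is false under `α`. -/
def Violates {V : Type*} (α : Assignment V) (C : Clause V) : Prop :=
  ∀ l ∈ C, α l.1 ≠ l.2

def Satisfies {V : Type*} (α : Assignment V) (F : CNF V) : Prop :=
  ∀ C ∈ F, ¬ Violates α C

/-- At most three literals per clause. -/
def IsThreeCNF {V : Type*} (F : CNF V) : Prop :=
  ∀ C ∈ F, C.card ≤ 3

/-- The all-ones assignment is the one and only satisfying assignment of `F`. -/
def UniquelySatisfiedByOnes {V : Type*} (F : CNF V) : Prop :=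
  ∀ α : Assignment V, Satisfies α F ↔ α = fun _ => true

/-- `C` is a critical clause of `F` for `a`: a clause of `F` that becomes violated when, in the
all-ones assignment, the value of `a` alone is flipped. -/
def IsCritical {V : Type*} [DecidableEq V] (F : CNF V) (a : V) (C : Clause V) : Prop :=
  C ∈ F ∧ Violates (Function.update (fun _ => true) a false) C

/-- `can` selects one critical clause for each variable, its canonical critical clause. -/
def IsCanonicalChoice {V : Type*} [DecidableEq V] (F : CNF V) (can : V → Clause V) : Prop :=
  ∀ a, IsCritical F a (can a)

/-- The graph `H`: `b` and `c` are joined if some canonical critical clause is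
`(a ∨ ¬b ∨ ¬c)`. -/
def pairGraph {V : Type*} [DecidableEq V] (can : V → Clause V) : SimpleGraph V where
  Adj b c := b ≠ c ∧ ∃ a, can a = {(a, true), (b, false), (c, false)}
  symm := ⟨by
    rintro b c ⟨hne, a, ha⟩
    refine ⟨hne.symm, a, ?_⟩
    rw [ha, Finset.pair_comm]⟩
  loopless := ⟨fun _ h => h.1 rfl⟩

/-! ### Critical clause trees -/

/-- Positions in the infinite binary tree, read from the root: the children of `v` are
`v ++ [false]` (left) and `v ++ [true]` (right), the ancestors of `v` (including `v`) are its
prefixes, and the depth of `v` is its length. -/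
abbrev Node := List Bool

/-- A critical clause tree of height `h` for the variable `x`, drawn inside the binary tree. -/
structure CriticalClauseTree {V : Type*} [DecidableEq V] (F : CNF V) (can : V → Clause V)
    (x : V) (h : ℕ) where
  /-- the variable label; `none` at the positions that are not nodes of the tree -/
  varLabel : Node → Option V
  /-- the clause label, used only at nodes of depth less than `h` -/
  clauseLabel : Node → Clause V
  /-- the assignment label of `v`: `0` at the variable labels on the path from the root to `v`
  (both ends included), `1` elsewhere -/
  assignment : Node → Assignment V
  assignment_eq : ∀ v a, assignment v a = false ↔ ∃ u, u <+: v ∧ varLabel u = some a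
  varLabel_root : varLabel [] = some x
  clauseLabel_mem : ∀ v, varLabel v ≠ none → v.length < h →
    clauseLabel v ∈ F ∧ Violates (assignment v) (clauseLabel v)
  /-- the canonical critical clause is used whenever it is available -/
  clauseLabel_canonical : ∀ v a, varLabel v = some a → v.length < h →
    Violates (assignment v) (can a) → clauseLabel v = can a
  /-- one child for each negative literal of the clause label -/
  children : ∀ v, varLabel v ≠ none → v.length < h →
    ∀ a, (∃ b, varLabel (v ++ [b]) = some a) ↔ (a, false) ∈ clauseLabel v
  children_distinct : ∀ v a, varLabel (v ++ [false]) = some a → varLabel (v ++ [true]) ≠ some a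
  /-- no other children -/
  no_children : ∀ v b, (varLabel v = none ∨ h ≤ v.length) → varLabel (v ++ [b]) = none

namespace CriticalClauseTree

variable {V : Type*} [DecidableEq V] {F : CNF V} {can : V → Clause V} {x : V} {h : ℕ}

def IsNode (T : CriticalClauseTree F can x h) (v : Node) : Prop :=
  T.varLabel v ≠ none

/-- `v` is canonical: on the path from the root to `v`, both ends included, every node carries
its canonical critical clause as clause label, and its variable is not in `TwoCC`. -/
def IsCanonical (T : CriticalClauseTree F can x h) (TwoCC : Set V) (v : Node) : Prop :=
  ∀ u, u <+: v →
    u.length < h ∧ ∃ a, T.varLabel u = some a ∧ a ∉ TwoCC ∧ T.clauseLabel u = can a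

/-- `v ◁ u`: the node `u` is a proper ancestor of the canonical node `v` and their two variables
are adjacent in `Hlow`. -/
def IsSubordinate (T : CriticalClauseTree F can x h) (TwoCC : Set V) (Hlow : SimpleGraph V)
    (v u : Node) : Prop :=
  T.IsCanonical TwoCC v ∧ u <+: v ∧ u ≠ v ∧
    ∃ a b, T.varLabel u = some a ∧ T.varLabel v = some b ∧ Hlow.Adj a b

end CriticalClauseTree

/-! ### The numerical quantities -/

noncomputable def gamma (r : ℝ) : ℝ :=
  if r < 1 / 2 then r * (1 - 2 * r) ^ (3 / 2 : ℝ) else 0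

noncomputable def phi (r : ℝ) : ℝ := deriv gamma r

noncomputable def deltaRoot (ε r : ℝ) : ℝ := max 0 (-(1.147 * ε * gamma r * phi r))

noncomputable def deltaNonRoot (ε r : ℝ) : ℝ := 1.147 * ε * gamma r ^ 2 / (1 - r)

noncomputable def deltaMax (ε r : ℝ) : ℝ :=
  max (1.147 * ε * (2 * gamma r ^ 2 / (1 - r)))
    (1.147 * ε * gamma r * (gamma r / (1 - r) - phi r))

/-- The probability of being cut (below the root) for the infinite binary tree with independent
uniform labels. -/
noncomputable def Q (r : ℝ) : ℝ := if r < 1 / 2 then (r / (1 - r)) ^ 2 else 1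

/-- One-child bonus. -/
noncomputable def OCB (ε : ℝ) (d : ℕ) (r : ℝ) : ℝ :=
  if r < 1 / 2 then
    (r * (1 - 2 * r) - 2 * deltaMax ε r * (1 - r)) / (1 - r) ^ 2
      * (r - deltaMax ε r / (1 - r)) ^ d
  else 0

/-- Multiple-label bonus. -/
noncomputable def MLB (ε : ℝ) (d : ℕ) (r : ℝ) : ℝ :=
  if r < 1 / 2 then
    (1 - Q r) ^ 2 * (r - deltaMax ε r / (1 - r)) ^ (d - 1) * r * (1 - r)
  else 0

open Classical in
/-- `δ_v`: the sum, over all bosses `u` of `v`, of `δ_root` or `δ_nonroot` according to whether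
`u` is the root. The proper ancestors of `v` are its prefixes of length `k < v.length`. -/
noncomputable def delta {V : Type*} [DecidableEq V] {F : CNF V} {can : V → Clause V} {x : V}
    {h : ℕ} (T : CriticalClauseTree F can x h) (TwoCC : Set V) (Hlow : SimpleGraph V)
    (ε r : ℝ) (v : Node) : ℝ :=
  ∑ k ∈ Finset.range v.length,
    if T.IsSubordinate TwoCC Hlow v (v.take k) then
      (if k = 0 then deltaRoot ε r else deltaNonRoot ε r)
    else 0

/-! ### Cleaned-up trees and the cut event -/

/-- The labels of the cleaned-up trees: the variable `z`, one fresh label for each node, and,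
for the partially cleaned-up tree, a further fresh label for each node that is in `B1` or below. -/
inductive Label where
  | z : Label
  | fresh (v : Node) : Label
  | below (v : Node) : Label

/-- A labelled subtree of the infinite binary tree. -/
structure LabelledTree where
  nodes : Set Node
  label : Node → Label

/-- The first `n` steps of the infinite path `s`. -/
def pathNode (s : ℕ → Bool) (n : ℕ) : Node := (List.range n).map s

/-- `Cut_r(T)` under the placement `p` of the labels: every infinite path in `T` starting at the
root contains a node other than the root whose label is placed before `r`. -/
def Cut (T : LabelledTree) (r : ℝ) (p : Label → ℝ) : Prop :=
  ∀ s : ℕ → Bool, (∀ n, pathNode s n ∈ T.nodes) → ∃ n, 1 ≤ n ∧ p (T.label (pathNode s n)) < r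

/-- The fully cleaned-up tree: missing children are added everywhere, so that it is the infinite
binary tree, and each node has a label of its own. -/
def cleanUp : LabelledTree where
  nodes := Set.univ
  label v := Label.fresh v

open Classical in
/-- The partially cleaned-up tree: as `cleanUp`, except that the nodes of `Bz` and the right child
of the root all carry the label `z`, the nodes of `B1` get no children besides those they have
in `T`, and the subtrees rooted at nodes of `B1` have fresh labels of their own. -/
noncomputable def partialCleanUp {V : Type*} [DecidableEq V] {F : CNF V} {can : V → Clause V}
    {x : V} {h : ℕ} (T : CriticalClauseTree F can x h) (B1 Bz : Finset Node) : LabelledTree where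
  nodes := {p | ∀ v ∈ B1, ∀ b, v ++ [b] <+: p → T.IsNode (v ++ [b])}
  label v :=
    if v ∈ Bz ∨ v = [true] then Label.z
    else if ∃ u ∈ B1, u <+: v then Label.below v
    else Label.fresh v

/-- The law of a random placement of the labels of the cleaned-up trees: the labels are placed
independently, `z` is placed before `r` with probability `r`, and the label of the node `v` with
probability `r - δ v`; for the labels used in the subtrees rooted at nodes of `B1` in the partially
cleaned-up tree this probability may be anything that is at least `r - dmax` (when `δ ≤ dmax`,
the value `r - δ v` is one possibility). -/
structure IsCleanPlacement {Ω : Type*} [MeasurableSpace Ω] (P : Measure Ω) (r : ℝ)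
    (δ : Node → ℝ) (dmax : ℝ) (π : Label → Ω → ℝ) : Prop where
  measurable : ∀ l, Measurable (π l)
  indep : iIndepFun π P
  prob_z : P.real {ω | π Label.z ω < r} = r
  prob_fresh : ∀ v, P.real {ω | π (Label.fresh v) ω < r} = r - δ v
  prob_below : ∀ v, r - dmax ≤ P.real {ω | π (Label.below v) ω < r}

/-- The sets `B_1` and `B_z` of nodes in the left subtree of `T`. -/
structure IsHarvest {V : Type*} [DecidableEq V] {F : CNF V} {can : V → Clause V} {x : V} {h : ℕ}
    (T : CriticalClauseTree F can x h) (TwoCC : Set V) (z : V) (B1 Bz : Finset Node) : Prop where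
  isNode : ∀ v ∈ B1 ∪ Bz, T.IsNode v
  left : ∀ v ∈ B1 ∪ Bz, [false] <+: v
  disjoint : Disjoint B1 Bz
  antichain : ∀ u ∈ B1 ∪ Bz, ∀ v ∈ B1 ∪ Bz, u <+: v → u = v
  label_Bz : ∀ v ∈ Bz, T.varLabel v = some z
  label_B1 : ∀ v ∈ B1, T.varLabel v ≠ some z
  /-- the nodes of `B1` lie above the truncation depth and have at most one child -/
  depth_B1 : ∀ v ∈ B1, v.length < h
  oneChild : ∀ v ∈ B1, ¬ (T.IsNode (v ++ [false]) ∧ T.IsNode (v ++ [true]))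
  canonical : ∀ v ∈ B1 ∪ Bz, ∀ u, u <+: v → u ≠ v → T.IsCanonical TwoCC u

end PPSZ

/-!
Mark a node of the infinite binary tree when its label is placed before `r`. A tree is cut exactly
when both children of the root are hit, where a node is hit if it is marked or both of its children
are hit, and hitting is the least solution of this recursion (`forall_path_iff_mem_hitEvent`). When
the marks are independent, the hitting probabilities `w` satisfy
`w u = p u + (1 - p u) * w (u0) * w (u1)`, and they lie between `s / (1 - s)` and `r / (1 - r)` if
all marking probabilities lie between `s` and `r` (`le_hitProb`, `hitProb_le`). Here
`s = r - δ_max`, because a node has at most two bosses (`delta_le_deltaMax`).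

In the partially cleaned-up tree the marks are independent given whether the shared label `z` is
placed early or late (`measureReal_cut_partialCleanUp`). Let `f₁ u` and `f₀ u` be the hitting
probabilities in these two cases and `f u` the one in the fully cleaned-up tree. Working from `B1`
and `Bz` towards the root (`IsHarvestProb.bonus_le`), one bounds from below the gain
`r f₁ + (1 - r) f₀ - f`, which each node of `B1` feeds with at least `2 s - r / (1 - r)`, and the
gap `f₁ - f₀`, which each node of `Bz` feeds with at least `1 - Q`; every node on the way up
multiplies by at least `κ = r - δ_max / (1 - r)`. The two subtrees of a node may both contain changed nodes,
but their contributions only reinforce each other (`product_step`; this uses `r < 1 / 2`). At the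
root the right child carries the label `z` as well, and the covariance turns the gap `f₁ - f₀` into
a gain of `r (1 - r) (1 - q) (f₁ - f₀)` (`IsHarvestProb.cut_inequality`). The bounds obtained are
exactly the one-child and multiple-label bonuses. Multiplying by `κ` is legitimate because the gains
are nonnegative, which is where `ε ≤ 1 / 10` enters (`two_mul_deltaMax_le`).
-/

namespace PPSZ

/-! ### Hitting probabilities on the binary tree -/

/-- The probability that, when each node `v` is marked independently with probability `p v`, every
path of `n` nodes that starts at `u` and leads away from the root contains a marked node. -/
def hitApprox (p : Node → ℝ) : ℕ → Node → ℝ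
  | 0, _ => 0
  | n + 1, u => p u + (1 - p u) * (hitApprox p n (u ++ [false]) * hitApprox p n (u ++ [true]))

/-- The probability that every infinite path from `u` contains a marked node (possibly `u`), when
each node `v` is marked independently with probability `p v`. By compactness it is the limit of
the probabilities for finite paths. -/
noncomputable def hitProb (p : Node → ℝ) (u : Node) : ℝ := ⨆ n, hitApprox p n u

section Numeric

variable {p p' : Node → ℝ}

/-- If `a` is the probability that a node is marked and `b` that its two subtrees are hit, then
the probability that the node is hit is monotone in both. -/
lemma mix_mono {a a' b b' : ℝ} (ha : a ≤ a') (hb : b ≤ b') (ha1 : a' ≤ 1) (hb1 : b ≤ 1) :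
    a + (1 - a) * b ≤ a' + (1 - a') * b' := by
  nlinarith [mul_nonneg (sub_nonneg.2 ha) (sub_nonneg.2 hb1),
    mul_nonneg (sub_nonneg.2 ha1) (sub_nonneg.2 hb)]

lemma hitApprox_mem (hp : ∀ v, p v ∈ Set.Icc (0 : ℝ) 1) (n : ℕ) (u : Node) :
    hitApprox p n u ∈ Set.Icc (0 : ℝ) 1 := by
  induction n generalizing u with
  | zero => simp [hitApprox]
  | succ n ih =>
    have h0 := ih (u ++ [false])
    have h1 := ih (u ++ [true])
    have hb0 := mul_nonneg h0.1 h1.1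
    have hb1 := mul_le_one₀ h0.2 h1.1 h1.2
    have hu := hp u
    constructor
    · exact add_nonneg hu.1 (mul_nonneg (sub_nonneg.2 hu.2) hb0)
    · rw [hitApprox]
      simpa using mix_mono hu.2 hb1 le_rfl hb1

lemma hitApprox_le_succ (hp : ∀ v, p v ∈ Set.Icc (0 : ℝ) 1) (n : ℕ) (u : Node) :
    hitApprox p n u ≤ hitApprox p (n + 1) u := by
  induction n generalizing u with
  | zero => exact (hitApprox_mem hp 1 u).1
  | succ n ih =>
    have h := fun b => hitApprox_mem hp n (u ++ [b])
    have h' := fun b => hitApprox_mem hp (n + 1) (u ++ [b])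
    exact mix_mono le_rfl (mul_le_mul (ih _) (ih _) (h _).1 (h' _).1) (hp u).2
      (mul_le_one₀ (h _).2 (h _).1 (h _).2)

lemma hitApprox_mono (hp : ∀ v, p v ∈ Set.Icc (0 : ℝ) 1) (u : Node) :
    Monotone fun n => hitApprox p n u :=
  monotone_nat_of_le_succ fun n => hitApprox_le_succ hp n u

lemma tendsto_hitApprox (hp : ∀ v, p v ∈ Set.Icc (0 : ℝ) 1) (u : Node) :
    Filter.Tendsto (fun n => hitApprox p n u) Filter.atTop (nhds (hitProb p u)) :=
  tendsto_atTop_ciSup (hitApprox_mono hp u)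
    ⟨1, by rintro _ ⟨n, rfl⟩; exact (hitApprox_mem hp n u).2⟩

lemma hitProb_mem (hp : ∀ v, p v ∈ Set.Icc (0 : ℝ) 1) (u : Node) :
    hitProb p u ∈ Set.Icc (0 : ℝ) 1 :=
  isClosed_Icc.mem_of_tendsto (tendsto_hitApprox hp u)
    (Filter.Eventually.of_forall fun n => hitApprox_mem hp n u)

lemma hitProb_eq (hp : ∀ v, p v ∈ Set.Icc (0 : ℝ) 1) (u : Node) :
    hitProb p u = p u + (1 - p u) * (hitProb p (u ++ [false]) * hitProb p (u ++ [true])) := by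
  refine tendsto_nhds_unique
    ((tendsto_hitApprox hp u).comp (Filter.tendsto_add_atTop_nat 1)) ?_
  exact tendsto_const_nhds.add (tendsto_const_nhds.mul
    ((tendsto_hitApprox hp _).mul (tendsto_hitApprox hp _)))

lemma hitProb_of_eq_one (hp : ∀ v, p v ∈ Set.Icc (0 : ℝ) 1) {u : Node} (hu : p u = 1) :
    hitProb p u = 1 := by
  rw [hitProb_eq hp, hu]; ring

lemma prefix_of_append_prefix {u v w : Node} (h : u ++ w <+: v) : u <+: v :=
  (List.prefix_append u w).trans h

lemma hitProb_congr {u : Node} (h : ∀ v, u <+: v → p v = p' v) :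
    hitProb p u = hitProb p' u := by
  have key : ∀ n v, u <+: v → hitApprox p n v = hitApprox p' n v := by
    intro n
    induction n with
    | zero => intro v _; rfl
    | succ n ih =>
      intro v hv
      simp only [hitApprox, h v hv, ih _ (hv.trans (List.prefix_append v _))]
  exact iSup_congr fun n => key n u List.prefix_rfl

lemma hitProb_le (hp : ∀ v, p v ∈ Set.Icc (0 : ℝ) 1) {r : ℝ} (hr0 : 0 ≤ r) (hr1 : r < 1 / 2)
    {u : Node} (h : ∀ v, u <+: v → p v ≤ r) : hitProb p u ≤ r / (1 - r) := by
  have hr : 0 < 1 - r := by linarith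
  -- `r / (1 - r)` solves the recursion with constant marking probability `r`
  have hfix : r + (1 - r) * (r / (1 - r) * (r / (1 - r))) = r / (1 - r) := by
    field_simp; ring
  have h1 : r / (1 - r) ≤ 1 := by rw [div_le_one hr]; linarith
  have h0 : 0 ≤ r / (1 - r) := by positivity
  have key : ∀ n v, u <+: v → hitApprox p n v ≤ r / (1 - r) := by
    intro n
    induction n with
    | zero => intro v _; exact h0
    | succ n ih =>
      intro v hv
      have hm := fun b => hitApprox_mem hp n (v ++ [b])
      have hi := fun b => ih (v ++ [b]) (hv.trans (List.prefix_append v _))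
      rw [← hfix]
      exact mix_mono (h v hv) (mul_le_mul (hi _) (hi _) (hm _).1 h0) (by linarith)
        (mul_le_one₀ (hm _).2 (hm _).1 (hm _).2)
  exact ciSup_le fun n => key n u List.prefix_rfl

/-- The infimum `I` of the hitting probabilities below `u` satisfies `I ≥ s + (1 - s) I²`, and
so does no number in `[0, s / (1 - s))`. -/
lemma le_hitProb (hp : ∀ v, p v ∈ Set.Icc (0 : ℝ) 1) {s : ℝ} (hs1 : s < 1 / 2)
    {u : Node} (h : ∀ v, u <+: v → s ≤ p v) : s / (1 - s) ≤ hitProb p u := by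
  have hs : 0 < 1 - s := by linarith
  set I : ℝ := ⨅ t : Node, hitProb p (u ++ t) with hI
  have hbdd : BddBelow (Set.range fun t : Node => hitProb p (u ++ t)) :=
    ⟨0, by rintro _ ⟨t, rfl⟩; exact (hitProb_mem hp _).1⟩
  have hle : ∀ t, I ≤ hitProb p (u ++ t) := fun t => ciInf_le hbdd t
  have hI0 : 0 ≤ I := le_ciInf fun t => (hitProb_mem hp _).1
  have hI1 : I ≤ 1 := (hle []).trans (hitProb_mem hp _).2
  have hrec : s + (1 - s) * (I * I) ≤ I := by
    refine le_ciInf fun t => ?_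
    rw [hitProb_eq hp]
    have h0 := hle (t ++ [false])
    have h1 := hle (t ++ [true])
    rw [← List.append_assoc] at h0 h1
    exact mix_mono (h _ (List.prefix_append u t)) (mul_le_mul h0 h1 hI0 (hitProb_mem hp _).1)
      (hp _).2 (mul_le_one₀ hI1 hI0 hI1)
  have hIu : I ≤ hitProb p u := by simpa using hle []
  refine le_trans ?_ hIu
  rw [div_le_iff₀ hs]
  by_contra! hlt
  have : 0 < (1 - I) * (s - I * (1 - s)) := by
    refine mul_pos ?_ (by linarith)
    by_contra! hc
    nlinarith
  nlinarith

end Numeric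

/-! ### Adding up the bonuses -/

lemma prefix_iff_eq_or_child {u v : Node} :
    u <+: v ↔ v = u ∨ u ++ [false] <+: v ∨ u ++ [true] <+: v := by
  constructor
  · rintro ⟨t, rfl⟩
    match t with
    | [] => simp
    | b :: t =>
      right
      have : u ++ b :: t = (u ++ [b]) ++ t := by simp
      cases b
      · left; rw [this]; exact List.prefix_append _ _
      · right; rw [this]; exact List.prefix_append _ _
  · rintro (rfl | h | h)
    · exact List.prefix_rfl
    all_goals exact prefix_of_append_prefix h

lemma not_child_prefix_both {u v : Node} (h0 : u ++ [false] <+: v) (h1 : u ++ [true] <+: v) :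
    False := by
  have := List.prefix_of_prefix_length_le h0 h1 (by simp)
  have := this.eq_of_length (by simp)
  simp at this

lemma child_prefix_length {u v : Node} {b : Bool} (h : u ++ [b] <+: v) :
    u.length + 1 ≤ v.length := by
  simpa using h.length_le

open Classical in
/-- The sum of `c * κ ^ d` over the nodes of `B` below `u`, where `d` is the distance from `u`. -/
noncomputable def bonus (B : Finset Node) (c κ : ℝ) (u : Node) : ℝ :=
  ∑ v ∈ B with u <+: v, c * κ ^ (v.length - u.length)

section Bonus

variable {B : Finset Node} {c κ : ℝ} {u : Node}

lemma bonus_nonneg (hc : 0 ≤ c) (hκ : 0 ≤ κ) : 0 ≤ bonus B c κ u :=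
  Finset.sum_nonneg fun _ _ => mul_nonneg hc (pow_nonneg hκ _)

lemma bonus_eq_zero (h : ∀ v ∈ B, ¬ u <+: v) : bonus B c κ u = 0 := by
  classical
  rw [bonus, Finset.filter_eq_empty_iff.2 (fun v hv => h v hv), Finset.sum_empty]

lemma bonus_self (hu : u ∈ B) (h : ∀ v ∈ B, u <+: v → v = u) : bonus B c κ u = c := by
  classical
  have : (B.filter fun v => u <+: v) = {u} := by
    ext v
    simp only [Finset.mem_filter, Finset.mem_singleton]
    refine ⟨fun hv => h v hv.1 hv.2, ?_⟩
    rintro rfl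
    exact ⟨hu, List.prefix_rfl⟩
  rw [bonus, this]; simp

lemma bonus_step (hu : u ∉ B) :
    bonus B c κ u = κ * (bonus B c κ (u ++ [false]) + bonus B c κ (u ++ [true])) := by
  classical
  have hsplit : (B.filter fun v => u <+: v) =
      (B.filter fun v => u ++ [false] <+: v) ∪ (B.filter fun v => u ++ [true] <+: v) := by
    ext v
    simp only [Finset.mem_filter, Finset.mem_union]
    constructor
    · rintro ⟨hv, hp⟩
      rcases prefix_iff_eq_or_child.1 hp with rfl | h | h
      · exact absurd hv hu
      · exact Or.inl ⟨hv, h⟩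
      · exact Or.inr ⟨hv, h⟩
    · rintro (⟨hv, hp⟩ | ⟨hv, hp⟩) <;> exact ⟨hv, prefix_of_append_prefix hp⟩
  have hdisj : Disjoint (B.filter fun v => u ++ [false] <+: v)
      (B.filter fun v => u ++ [true] <+: v) := by
    rw [Finset.disjoint_left]
    intro v h0 h1
    exact not_child_prefix_both (Finset.mem_filter.1 h0).2 (Finset.mem_filter.1 h1).2
  have hchild : ∀ b, ∑ v ∈ B with u ++ [b] <+: v, c * κ ^ (v.length - u.length) =
      κ * bonus B c κ (u ++ [b]) := by
    intro b
    rw [bonus, Finset.mul_sum]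
    refine Finset.sum_congr rfl fun v hv => ?_
    have := child_prefix_length (Finset.mem_filter.1 hv).2
    rw [List.length_append, List.length_singleton,
      show v.length - u.length = (v.length - (u.length + 1)) + 1 by omega, pow_succ]
    ring
  rw [bonus, hsplit, Finset.sum_union hdisj, hchild, hchild]
  ring

end Bonus

/-- The effect of one node above the changed part of the tree. In the two subtrees, `fᵢ` and `gᵢ`
are the hitting probabilities given that `z` is placed early (`i = 1`) or late (`i = 0`), and `f`,
`g` those of the unmodified tree. -/
lemma product_step {r f g f0 f1 g0 g1 : ℝ} (hr0 : 0 ≤ r) (hr1 : r < 1 / 2)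
    (hf : f0 ≤ f1) (hg : g0 ≤ g1)
    (hmf : f ≤ r * f1 + (1 - r) * f0) (hmg : g ≤ r * g1 + (1 - r) * g0) :
    (r * f1 + (1 - r) * f0) * (r * g1 + (1 - r) * g0) ≤ r * (f1 * g1) + (1 - r) * (f0 * g0) ∧
    (f1 - f0) * g + (g1 - g0) * f ≤ f1 * g1 - f0 * g0 := by
  have hpos := mul_nonneg (sub_nonneg.2 hf) (sub_nonneg.2 hg)
  constructor
  · nlinarith [mul_nonneg (mul_nonneg hr0 (by linarith : 0 ≤ 1 - r)) hpos]
  · -- replace `f` and `g` by their upper bounds; the excess is `(1 - 2r) (f1 - f0) (g1 - g0)`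
    nlinarith [mul_nonneg (sub_nonneg.2 hf) (sub_nonneg.2 hmg),
      mul_nonneg (sub_nonneg.2 hg) (sub_nonneg.2 hmf),
      mul_nonneg (by linarith : 0 ≤ 1 - 2 * r) hpos]

/-- Marking probabilities on the infinite binary tree: `pF` for the fully cleaned-up tree, `p1` and
`p0` for the partially cleaned-up tree given that the label `z` is placed early or late. Missing
nodes of the partially cleaned-up tree count as marked. The number `s` is a lower bound for the
marking probabilities before conditioning on `z`. -/
structure IsHarvestProb (r s : ℝ) (B1 Bz : Finset Node) (pF p0 p1 : Node → ℝ) : Prop where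
  pF_mem : ∀ v, pF v ∈ Set.Icc s r
  p0_mem : ∀ v, p0 v ∈ Set.Icc (0 : ℝ) 1
  p1_mem : ∀ v, p1 v ∈ Set.Icc (0 : ℝ) 1
  antichain : ∀ u ∈ B1 ∪ Bz, ∀ v ∈ B1 ∪ Bz, u <+: v → u = v
  disjoint : Disjoint B1 Bz
  left : ∀ v ∈ B1 ∪ Bz, [false] <+: v
  unchanged : ∀ v, v ∉ Bz → v ≠ [true] → (∀ b ∈ B1, ¬ b <+: v) → p0 v = pF v ∧ p1 v = pF v
  z_nodes : ∀ v, v ∈ Bz ∨ v = [true] → pF v = r ∧ p0 v = 0 ∧ p1 v = 1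
  below : ∀ b ∈ B1, ∀ v, b <+: v → p0 v = p1 v ∧ s ≤ p0 v
  missing : ∀ b ∈ B1, ∃ c, p0 (b ++ [c]) = 1

section Harvest

variable {r s : ℝ} {B1 Bz : Finset Node} {pF p0 p1 : Node → ℝ}

lemma IsHarvestProb.pF_mem01 (H : IsHarvestProb r s B1 Bz pF p0 p1) (hs0 : 0 ≤ s)
    (hr1 : r < 1 / 2) (v : Node) : pF v ∈ Set.Icc (0 : ℝ) 1 :=
  ⟨hs0.trans (H.pF_mem v).1, (H.pF_mem v).2.trans (by linarith)⟩

lemma IsHarvestProb.pF_prod_le (H : IsHarvestProb r s B1 Bz pF p0 p1) (hs0 : 0 ≤ s)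
    (hr0 : 0 ≤ r) (hr1 : r < 1 / 2) (u : Node) :
    hitProb pF (u ++ [false]) * hitProb pF (u ++ [true]) ≤ (r / (1 - r)) ^ 2 := by
  have hF := H.pF_mem01 hs0 hr1
  have hle := fun u => hitProb_le hF hr0 hr1 (u := u) fun v _ => (H.pF_mem v).2
  rw [sq]
  exact mul_le_mul (hle _) (hle _) (hitProb_mem hF _).1
    (div_nonneg hr0 (by linarith))

lemma not_left_of_right {v : Node} (h0 : [false] <+: v) (h1 : [true] <+: v) : False :=
  not_child_prefix_both (u := []) h0 h1

/-- Induction from the nodes of `B1` and `Bz` towards the root: every node in between multiplies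
the gain by at least `κ`. -/
lemma IsHarvestProb.bonus_le (H : IsHarvestProb r s B1 Bz pF p0 p1) {κ : ℝ} (hs0 : 0 ≤ s)
    (hsr : s ≤ r) (hr1 : r < 1 / 2) (hκ0 : 0 ≤ κ) (hκ : κ ≤ (1 - r) * (s / (1 - s)))
    (hD : 0 ≤ 2 * s - r / (1 - r)) (n : ℕ) :
    ∀ u, [false] <+: u → (∀ v ∈ B1 ∪ Bz, v <+: u → v = u) →
      (∀ v ∈ B1 ∪ Bz, v.length < u.length + n) →
      bonus B1 (2 * s - r / (1 - r)) κ u ≤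
        r * hitProb p1 u + (1 - r) * hitProb p0 u - hitProb pF u ∧
      bonus Bz (1 - (r / (1 - r)) ^ 2) κ u ≤ hitProb p1 u - hitProb p0 u := by
  have hr0 : 0 ≤ r := hs0.trans hsr
  have hr : 0 < 1 - r := by linarith
  have hQ : 0 ≤ 1 - (r / (1 - r)) ^ 2 := by
    have h0 : 0 ≤ r / (1 - r) := by positivity
    have h1 : r / (1 - r) ≤ 1 := by rw [div_le_one hr]; linarith
    nlinarith
  have hF := H.pF_mem01 hs0 hr1
  have hlow : ∀ u, s / (1 - s) ≤ hitProb pF u := fun u =>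
    le_hitProb hF (by linarith) fun v _ => (H.pF_mem v).1
  -- a subtree in which nothing is changed
  have hsame : ∀ u, (∀ v, u <+: v → p0 v = pF v ∧ p1 v = pF v) →
      hitProb p0 u = hitProb pF u ∧ hitProb p1 u = hitProb pF u := fun u h =>
    ⟨hitProb_congr fun v hv => (h v hv).1, hitProb_congr fun v hv => (h v hv).2⟩
  induction n with
  | zero =>
    intro u hu hmin hlen
    have hno : ∀ v ∈ B1 ∪ Bz, ¬ u <+: v := fun v hv h => by
      have := hlen v hv; have := h.length_le; omega
    have hs := hsame u fun v hv => by
      refine H.unchanged v (fun hz => hno v (by simp [hz]) hv) ?_ ?_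
      · rintro rfl
        exact not_left_of_right (hu.trans hv) List.prefix_rfl
      · intro b hb hbv
        rcases List.prefix_or_prefix_of_prefix hbv hv with h | h
        · exact hno b (by simp [hb]) (hmin b (by simp [hb]) h ▸ List.prefix_rfl)
        · exact hno b (by simp [hb]) h
    rw [bonus_eq_zero fun v hv => hno v (by simp [hv]),
      bonus_eq_zero fun v hv => hno v (by simp [hv]), hs.1, hs.2]
    constructor <;> linarith
  | succ n ih =>
    intro u hu hmin hlen
    have hu_right : ∀ v, u <+: v → v ≠ [true] := by
      rintro v hv rfl
      exact not_left_of_right (hu.trans hv) List.prefix_rfl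
    by_cases hu1 : u ∈ B1
    · have honly : ∀ v ∈ B1 ∪ Bz, u <+: v → v = u := fun v hv h =>
        (H.antichain u (by simp [hu1]) v hv h).symm
      have heq : hitProb p0 u = hitProb p1 u := hitProb_congr fun v hv => (H.below u hu1 v hv).1
      rw [bonus_self hu1 fun v hv => honly v (by simp [hv]),
        bonus_eq_zero (B := Bz) fun v hv h =>
          Finset.disjoint_left.1 H.disjoint hu1 (honly v (by simp [hv]) h ▸ hv), ← heq]
      refine ⟨?_, by simp⟩
      have hupp := hitProb_le hF hr0 hr1 (u := u) fun v _ => (H.pF_mem v).2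
      have hlow0 : ∀ b, s / (1 - s) ≤ hitProb p0 (u ++ [b]) := fun b =>
        le_hitProb H.p0_mem (by linarith) fun v hv =>
          (H.below u hu1 v (prefix_of_append_prefix hv)).2
      -- one child is missing, the other is hit with probability at least `s / (1 - s)`
      have hprod : s / (1 - s) ≤ hitProb p0 (u ++ [false]) * hitProb p0 (u ++ [true]) := by
        obtain ⟨c, hc⟩ := H.missing u hu1
        have h1 := hitProb_of_eq_one H.p0_mem hc
        cases c
        · rw [h1, one_mul]; exact hlow0 _
        · rw [h1, mul_one]; exact hlow0 _
      have hs1 : 0 < 1 - s := by linarith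
      have h2s : 2 * s ≤ hitProb p0 u := by
        rw [hitProb_eq H.p0_mem]
        calc 2 * s = s + (1 - s) * (s / (1 - s)) := by field_simp; ring
          _ ≤ _ := mix_mono (H.below u hu1 u List.prefix_rfl).2 hprod (H.p0_mem u).2
            (by rw [div_le_one hs1]; linarith)
      linarith
    by_cases huz : u ∈ Bz
    · have honly : ∀ v ∈ B1 ∪ Bz, u <+: v → v = u := fun v hv h =>
        (H.antichain u (by simp [huz]) v hv h).symm
      rw [bonus_eq_zero (B := B1) fun v hv h => hu1 (honly v (by simp [hv]) h ▸ hv),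
        bonus_self huz fun v hv => honly v (by simp [hv])]
      obtain ⟨hzF, hz0, hz1⟩ := H.z_nodes u (Or.inl huz)
      have hchild : ∀ b, hitProb p0 (u ++ [b]) = hitProb pF (u ++ [b]) := fun b => by
        refine (hsame _ fun v hv => ?_).1
        have huv := prefix_of_append_prefix hv
        refine H.unchanged v (fun hz => ?_) (hu_right v huv) fun w hw hwv => ?_
        · have := honly v (by simp [hz]) huv
          have := child_prefix_length hv
          simp_all
        · rcases List.prefix_or_prefix_of_prefix hwv huv with h | h
          · exact hu1 (hmin w (by simp [hw]) h ▸ hw)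
          · exact hu1 (honly w (by simp [hw]) h ▸ hw)
      have hprod := H.pF_prod_le hs0 hr0 hr1 u
      rw [hitProb_of_eq_one H.p1_mem hz1, hitProb_eq H.p0_mem, hitProb_eq hF u, hzF, hz0,
        hchild, hchild]
      constructor <;> linarith
    · have hnot : ∀ v ∈ B1 ∪ Bz, ¬ v <+: u := fun v hv h => by
        have := hmin v hv h
        subst this
        simp_all
      have hchild := fun b => ih (u ++ [b]) (hu.trans (List.prefix_append u _))
        (fun v hv h => by
          rcases List.prefix_concat_iff.1 h with h | h
          · exact h
          · exact absurd h (hnot v hv))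
        (fun v hv => by have := hlen v hv; simp; omega)
      obtain ⟨ha0, hb0⟩ := hchild false
      obtain ⟨ha1, hb1⟩ := hchild true
      obtain ⟨h0F, h1F⟩ := H.unchanged u huz (hu_right u List.prefix_rfl)
        fun b hb => hnot b (by simp [hb])
      rw [bonus_step hu1, bonus_step huz, hitProb_eq H.p0_mem u, hitProb_eq H.p1_mem u,
        hitProb_eq hF u, h0F, h1F]
      have hpu := H.pF_mem u
      have hl0 := hlow (u ++ [false])
      have hl1 := hlow (u ++ [true])
      have hn := fun b => bonus_nonneg (B := B1) (u := u ++ [b]) hD hκ0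
      have hnz := fun b => bonus_nonneg (B := Bz) (u := u ++ [b]) hQ hκ0
      have hn0 := hn false
      have hn1 := hn true
      have hnz0 := hnz false
      have hnz1 := hnz true
      -- the factor by which the gain of one child is multiplied, `g` belonging to the other child
      have hfac : ∀ {g a x : ℝ}, s / (1 - s) ≤ g → 0 ≤ a → a ≤ x →
          κ * a ≤ (1 - pF u) * (x * g) := fun {g a x} hg ha hx => by
        have hs' : 0 ≤ s / (1 - s) := div_nonneg hs0 (by linarith)
        have h1 : κ ≤ (1 - pF u) * g :=
          hκ.trans (mul_le_mul (by linarith [hpu.2]) hg hs' (by linarith [hpu.2]))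
        calc κ * a ≤ ((1 - pF u) * g) * x := mul_le_mul h1 hx ha (hκ0.trans h1)
          _ = _ := by ring
      generalize bonus B1 (2 * s - r / (1 - r)) κ (u ++ [false]) = S0 at *
      generalize bonus B1 (2 * s - r / (1 - r)) κ (u ++ [true]) = S1 at *
      generalize bonus Bz (1 - (r / (1 - r)) ^ 2) κ (u ++ [false]) = Z0 at *
      generalize bonus Bz (1 - (r / (1 - r)) ^ 2) κ (u ++ [true]) = Z1 at *
      generalize hitProb pF (u ++ [false]) = f at *
      generalize hitProb pF (u ++ [true]) = g at *
      generalize hitProb p0 (u ++ [false]) = f0 at *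
      generalize hitProb p0 (u ++ [true]) = g0 at *
      generalize hitProb p1 (u ++ [false]) = f1 at *
      generalize hitProb p1 (u ++ [true]) = g1 at *
      obtain ⟨hm, hd⟩ := product_step hr0 hr1 (f := f) (g := g) (by linarith : f0 ≤ f1)
        (by linarith : g0 ≤ g1) (by linarith) (by linarith)
      have hq : 0 ≤ 1 - pF u := by linarith [hpu.2]
      constructor
      · have e0 := hfac hl1 hn0 ha0
        have e1 := hfac hl0 hn1 ha1
        have e2 := mul_le_mul_of_nonneg_left hm hq
        have e3 := mul_nonneg hq (mul_nonneg (hn0.trans ha0) (hn1.trans ha1))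
        nlinarith
      · have e0 := hfac hl1 hnz0 hb0
        have e1 := hfac hl0 hnz1 hb1
        have e2 := mul_le_mul_of_nonneg_left hd hq
        nlinarith

/-- The inequality between the cut probabilities of the two cleaned-up trees, in terms of hitting
probabilities: the correlation between the label `z` at the right child of the root and at the
nodes of `Bz` contributes `r (1 - r) (1 - q) (f₁ - f₀)`, where `q` is the probability that the right
child is cut below, and the nodes of `B1` raise the mean `r f₁ + (1 - r) f₀`. -/
lemma IsHarvestProb.cut_inequality (H : IsHarvestProb r s B1 Bz pF p0 p1) {κ : ℝ} (hs0 : 0 ≤ s)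
    (hsr : s ≤ r) (hr1 : r < 1 / 2) (hκ0 : 0 ≤ κ) (hκ : κ ≤ (1 - r) * (s / (1 - s)))
    (hD : 0 ≤ 2 * s - r / (1 - r)) :
    hitProb pF [false] * hitProb pF [true] +
        bonus B1 (2 * s - r / (1 - r)) κ [false] * (κ / (1 - r)) +
        bonus Bz (1 - (r / (1 - r)) ^ 2) κ [false] * (r * (1 - r) * (1 - (r / (1 - r)) ^ 2)) ≤
      r * hitProb p1 [false] + (1 - r) * (hitProb p0 [false] * hitProb p0 [true]) := by
  have hr0 : 0 ≤ r := hs0.trans hsr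
  have hr : 0 < 1 - r := by linarith
  have hF := H.pF_mem01 hs0 hr1
  have hQ : 0 ≤ 1 - (r / (1 - r)) ^ 2 := by
    have h0 : 0 ≤ r / (1 - r) := by positivity
    have h1 : r / (1 - r) ≤ 1 := by rw [div_le_one hr]; linarith
    nlinarith
  obtain ⟨ha, hb⟩ := H.bonus_le hs0 hsr hr1 hκ0 hκ hD
    ((B1 ∪ Bz).sup List.length) [false] List.prefix_rfl
    (fun v hv h => (h.eq_of_length_le (H.left v hv).length_le))
    (fun v hv => by
      have := Finset.le_sup (f := List.length) hv
      simp only [List.length_singleton]; omega)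
  obtain ⟨hzF, hz0, hz1⟩ := H.z_nodes [true] (Or.inr rfl)
  have hchild : ∀ b, hitProb p0 ([true] ++ [b]) = hitProb pF ([true] ++ [b]) := fun b => by
    refine hitProb_congr fun v hv => ?_
    have hv' := prefix_of_append_prefix hv
    refine (H.unchanged v (fun h => not_left_of_right (H.left v (by simp [h])) hv') ?_
      fun w hw hwv => not_left_of_right ((H.left w (by simp [hw])).trans hwv) hv').1
    rintro rfl
    simpa using child_prefix_length hv
  have hq := H.pF_prod_le hs0 hr0 hr1 [true]
  have hlow : κ / (1 - r) ≤ hitProb pF [true] := by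
    refine le_trans ?_ (le_hitProb hF (s := s) (by linarith) fun v _ => (H.pF_mem v).1)
    rw [div_le_iff₀ hr]; linarith
  have hn := bonus_nonneg (B := B1) (u := [false]) hD hκ0
  have hnz := bonus_nonneg (B := Bz) (u := [false]) hQ hκ0
  rw [hitProb_eq hF [true], hzF] at hlow ⊢
  rw [hitProb_eq H.p0_mem [true], hz0, hchild, hchild]
  generalize bonus B1 (2 * s - r / (1 - r)) κ [false] = S at *
  generalize bonus Bz (1 - (r / (1 - r)) ^ 2) κ [false] = Z at *
  generalize hitProb pF ([true] ++ [false]) * hitProb pF ([true] ++ [true]) = q at *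
  have e1 : S * (κ / (1 - r)) ≤
      (r * hitProb p1 [false] + (1 - r) * hitProb p0 [false] - hitProb pF [false]) *
        (r + (1 - r) * q) :=
    mul_le_mul ha hlow (by positivity) (hn.trans ha)
  have e2 : Z * (r * (1 - r) * (1 - (r / (1 - r)) ^ 2)) ≤
      (hitProb p1 [false] - hitProb p0 [false]) * (r * (1 - r) * (1 - q)) :=
    mul_le_mul hb (mul_le_mul_of_nonneg_left (by linarith) (by positivity)) (by positivity)
      (hnz.trans hb)
  nlinarith

end Harvest

/-! ### Hitting events -/

/-- The event that every path of `n` nodes that starts at `u` and leads away from the root contains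
a marked node; `E v` is the event that `v` is marked. -/
def hitSet {Ω : Type*} (E : Node → Set Ω) : ℕ → Node → Set Ω
  | 0, _ => ∅
  | n + 1, u => E u ∪ (hitSet E n (u ++ [false]) ∩ hitSet E n (u ++ [true]))

/-- The event that for some `n` every path of `n` nodes from `u` contains a marked node. -/
def hitEvent {Ω : Type*} (E : Node → Set Ω) (u : Node) : Set Ω := ⋃ n, hitSet E n u

section Events

variable {Ω : Type*} {E : Node → Set Ω}

lemma hitSet_subset_succ (n : ℕ) (u : Node) : hitSet E n u ⊆ hitSet E (n + 1) u := by
  induction n generalizing u with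
  | zero => exact Set.empty_subset _
  | succ n ih => exact Set.union_subset_union_right _ (Set.inter_subset_inter (ih _) (ih _))

lemma hitSet_mono (u : Node) : Monotone fun n => hitSet E n u :=
  monotone_nat_of_le_succ fun n => hitSet_subset_succ n u

lemma mem_hitEvent_iff {u : Node} {ω : Ω} :
    ω ∈ hitEvent E u ↔
      ω ∈ E u ∨ (ω ∈ hitEvent E (u ++ [false]) ∧ ω ∈ hitEvent E (u ++ [true])) := by
  simp only [hitEvent, Set.mem_iUnion]
  constructor
  · rintro ⟨n, hn⟩
    cases n with
    | zero => exact absurd hn (Set.notMem_empty _)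
    | succ n =>
      rcases hn with h | h
      · exact Or.inl h
      · exact Or.inr ⟨⟨n, h.1⟩, ⟨n, h.2⟩⟩
  · rintro (h | ⟨⟨n, hn⟩, ⟨m, hm⟩⟩)
    · exact ⟨1, Or.inl h⟩
    · exact ⟨max n m + 1, Or.inr ⟨hitSet_mono _ (le_max_left n m) hn,
        hitSet_mono _ (le_max_right n m) hm⟩⟩

lemma pathNode_succ (s : ℕ → Bool) (n : ℕ) : pathNode s (n + 1) = pathNode s n ++ [s n] := by
  simp [pathNode, List.range_succ]

lemma exists_marked_of_mem_hitSet {ω : Ω} (s : ℕ → Bool) (n : ℕ) :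
    ∀ k, ω ∈ hitSet E n (pathNode s k) → ∃ m, k ≤ m ∧ ω ∈ E (pathNode s m) := by
  induction n with
  | zero => intro k h; exact absurd h (Set.notMem_empty _)
  | succ n ih =>
    intro k h
    rcases h with h | h
    · exact ⟨k, le_rfl, h⟩
    · have h' : ω ∈ hitSet E n (pathNode s (k + 1)) := by
        rw [pathNode_succ]
        cases s k
        · exact h.1
        · exact h.2
      obtain ⟨m, hm, hE⟩ := ih (k + 1) h'
      exact ⟨m, by omega, hE⟩

/-- König's lemma: if every infinite path that starts below `root` is marked, then paths of bounded
length already are. An unmarked path is built by stepping to a child that is not hit. -/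
lemma forall_path_iff_mem_hitEvent {ω : Ω} :
    (∀ s : ℕ → Bool, ∃ n, 1 ≤ n ∧ ω ∈ E (pathNode s n)) ↔
      ω ∈ hitEvent E [false] ∧ ω ∈ hitEvent E [true] := by
  constructor
  · intro hall
    by_contra hnot
    classical
    have hstep : ∀ u, ¬ (ω ∈ hitEvent E (u ++ [false]) ∧ ω ∈ hitEvent E (u ++ [true])) →
        ∃ b, ω ∉ hitEvent E (u ++ [b]) := by
      intro u h
      by_contra! hc
      exact h ⟨hc false, hc true⟩
    choose! next hnext using hstep
    let node : ℕ → Node := fun n => Nat.rec [] (fun _ u => u ++ [next u]) n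
    have hpath : ∀ n, pathNode (fun n => next (node n)) n = node n := by
      intro n
      induction n with
      | zero => rfl
      | succ n ih => rw [pathNode_succ, ih]
    have hno : ∀ n, ω ∉ hitEvent E (node (n + 1)) := by
      intro n
      induction n with
      | zero => exact hnext [] hnot
      | succ n ih => exact hnext _ fun h => ih (mem_hitEvent_iff.2 (Or.inr h))
    obtain ⟨n, hn, hE⟩ := hall fun n => next (node n)
    obtain ⟨m, rfl⟩ : ∃ m, n = m + 1 := ⟨n - 1, by omega⟩
    rw [hpath] at hE
    exact hno m (mem_hitEvent_iff.2 (Or.inl hE))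
  · rintro ⟨h0, h1⟩ s
    have h : ω ∈ hitEvent E (pathNode s 1) := by
      have : pathNode s 1 = [s 0] := by simp [pathNode]
      rw [this]
      cases s 0
      · exact h0
      · exact h1
    obtain ⟨n, hn⟩ := Set.mem_iUnion.1 h
    exact exists_marked_of_mem_hitSet s n 1 hn

variable {m : Node → MeasurableSpace Ω}

lemma measurableSet_hitSet (hE : ∀ v, MeasurableSet[m v] (E v)) (n : ℕ) (u : Node) :
    MeasurableSet[⨆ v ∈ {v : Node | u <+: v}, m v] (hitSet E n u) := by
  induction n generalizing u with
  | zero => exact @MeasurableSet.empty _ (_)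
  | succ n ih =>
    have hchild : ∀ b, MeasurableSet[⨆ v ∈ {v : Node | u <+: v}, m v] (hitSet E n (u ++ [b])) :=
      fun b => (biSup_mono fun v (hv : u ++ [b] <+: v) => prefix_of_append_prefix hv :
        (⨆ v ∈ {v : Node | u ++ [b] <+: v}, m v) ≤ ⨆ v ∈ {v : Node | u <+: v}, m v) _ (ih _)
    have hu : MeasurableSet[⨆ v ∈ {v : Node | u <+: v}, m v] (E u) :=
      (le_biSup m (i := u) (show u ∈ {v : Node | u <+: v} from List.prefix_rfl)) _ (hE u)
    exact @MeasurableSet.union _ (_) _ _ hu (@MeasurableSet.inter _ (_) _ _ (hchild _) (hchild _))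

lemma measurableSet_hitEvent (hE : ∀ v, MeasurableSet[m v] (E v)) (u : Node) :
    MeasurableSet[⨆ v ∈ {v : Node | u <+: v}, m v] (hitEvent E u) :=
  @MeasurableSet.iUnion _ _ (_) _ _ fun n => measurableSet_hitSet hE n u

variable [mΩ : MeasurableSpace Ω] {P : Measure Ω}

lemma indep_children (hm : ∀ v, m v ≤ mΩ) (hind : iIndep m P) (u : Node) :
    Indep (⨆ v ∈ {v : Node | u ++ [false] <+: v}, m v)
      (⨆ v ∈ {v : Node | u ++ [true] <+: v}, m v) P :=
  indep_iSup_of_disjoint hm hind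
    (Set.disjoint_left.2 fun _ h0 h1 => not_child_prefix_both h0 h1)

lemma measureReal_inter_of_indep {m₁ m₂ : MeasurableSpace Ω} (h : Indep m₁ m₂ P) {A B : Set Ω}
    (hA : MeasurableSet[m₁] A) (hB : MeasurableSet[m₂] B) :
    P.real (A ∩ B) = P.real A * P.real B := by
  simp only [measureReal_def, (Indep_iff _ _ _).1 h A B hA hB, ENNReal.toReal_mul]

variable [IsProbabilityMeasure P]

lemma measureReal_union_of_indep {m₁ m₂ : MeasurableSpace Ω} (h : Indep m₁ m₂ P)
    (h₂ : m₂ ≤ mΩ) {A B : Set Ω} (hA : MeasurableSet[m₁] A)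
    (hB : MeasurableSet[m₂] B) :
    P.real (A ∪ B) = P.real A + (1 - P.real A) * P.real B := by
  have h' := measureReal_union_add_inter (μ := P) (s := A) (h₂ _ hB)
  rw [@measureReal_inter_of_indep _ mΩ P _ _ h _ _ hA hB] at h'
  linarith

lemma measureReal_hitSet (hm : ∀ v, m v ≤ mΩ) (hind : iIndep m P)
    (hE : ∀ v, MeasurableSet[m v] (E v)) (n : ℕ) (u : Node) :
    P.real (hitSet E n u) = hitApprox (fun v => P.real (E v)) n u := by
  induction n generalizing u with
  | zero => simp [hitSet, hitApprox]
  | succ n ih =>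
    have hsub : ∀ b, (⨆ v ∈ {v : Node | u ++ [b] <+: v}, m v) ≤
        ⨆ v ∈ {v : Node | v ≠ u}, m v := fun b =>
      biSup_mono fun v (hv : u ++ [b] <+: v) => by
        rintro rfl
        simpa using child_prefix_length hv
    have hroot : Indep (m u) (⨆ v ∈ {v : Node | v ≠ u}, m v) P := by
      have := indep_iSup_of_disjoint hm hind (S := {u}) (T := {v : Node | v ≠ u})
        (Set.disjoint_left.2 fun _ h0 h1 => h1 h0)
      simpa using this
    rw [hitSet, hitApprox, measureReal_union_of_indep hroot
      (iSup₂_le fun v _ => hm v) (hE u), measureReal_inter_of_indep (indep_children hm hind u)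
      (measurableSet_hitSet hE n _) (measurableSet_hitSet hE n _), ih, ih]
    exact @MeasurableSet.inter _ (_) _ _ (hsub _ _ (measurableSet_hitSet hE n _))
      (hsub _ _ (measurableSet_hitSet hE n _))

lemma measureReal_hitEvent (hm : ∀ v, m v ≤ mΩ) (hind : iIndep m P)
    (hE : ∀ v, MeasurableSet[m v] (E v)) (u : Node) :
    P.real (hitEvent E u) = hitProb (fun v => P.real (E v)) u := by
  have h1 : Filter.Tendsto (fun n => P.real (hitSet E n u)) Filter.atTop
      (nhds (P.real (hitEvent E u))) :=
    (ENNReal.tendsto_toReal (measure_ne_top P _)).comp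
      (tendsto_measure_iUnion_atTop (hitSet_mono u))
  simp only [measureReal_hitSet hm hind hE] at h1
  exact tendsto_nhds_unique h1
    (tendsto_hitApprox (fun v => ⟨measureReal_nonneg, measureReal_le_one⟩) u)

lemma measureReal_hitEvent_children (hm : ∀ v, m v ≤ mΩ) (hind : iIndep m P)
    (hE : ∀ v, MeasurableSet[m v] (E v)) (u : Node) :
    P.real (hitEvent E (u ++ [false]) ∩ hitEvent E (u ++ [true])) =
      hitProb (fun v => P.real (E v)) (u ++ [false]) *
      hitProb (fun v => P.real (E v)) (u ++ [true]) := by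
  rw [measureReal_inter_of_indep (indep_children hm hind u) (measurableSet_hitEvent hE _)
    (measurableSet_hitEvent hE _), measureReal_hitEvent hm hind hE, measureReal_hitEvent hm hind hE]

end Events

/-! ### The cut events as hitting events -/

section CutEvents

variable {V : Type*} [DecidableEq V] {F : CNF V} {can : V → Clause V} {x : V} {h : ℕ}

open Classical in
/-- The label of a node of the partially cleaned-up tree before the label `z` is identified. -/
noncomputable def ownLabel (B1 : Finset Node) (v : Node) : Label :=
  if ∃ u ∈ B1, u <+: v then Label.below v else Label.fresh v

lemma ownLabel_injective (B1 : Finset Node) : Function.Injective (ownLabel B1) := by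
  intro u v huv
  unfold ownLabel at huv
  split_ifs at huv <;> simpa using huv

lemma ownLabel_ne_z (B1 : Finset Node) (v : Node) : ownLabel B1 v ≠ Label.z := by
  unfold ownLabel
  split_ifs <;> simp

open Classical in
/-- The event that `v` is marked in the partially cleaned-up tree, given whether the label `z` is
placed early (`early = True`) or late; missing nodes count as marked. -/
noncomputable def markEvent {Ω : Type*} (T : CriticalClauseTree F can x h) (B1 Bz : Finset Node)
    (r : ℝ) (π : Label → Ω → ℝ) (early : Prop) (v : Node) : Set Ω :=
  if v ∈ (partialCleanUp T B1 Bz).nodes then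
    if v ∈ Bz ∨ v = [true] then {_ω | early} else {ω | π (ownLabel B1 v) ω < r}
  else Set.univ

variable {Ω : Type*} {T : CriticalClauseTree F can x h} {B1 Bz : Finset Node}
  {r : ℝ} {π : Label → Ω → ℝ}

lemma mem_markEvent_iff {early : Prop} {ω : Ω} (hω : π Label.z ω < r ↔ early) (v : Node) :
    ω ∈ markEvent T B1 Bz r π early v ↔
      (v ∈ (partialCleanUp T B1 Bz).nodes → π ((partialCleanUp T B1 Bz).label v) ω < r) := by
  unfold markEvent
  split_ifs with h1 h2
  · have : (partialCleanUp T B1 Bz).label v = Label.z := if_pos h2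
    simp [this, hω, h1]
  · have : (partialCleanUp T B1 Bz).label v = ownLabel B1 v := if_neg h2
    simp [this, h1]
  · simp [h1]

lemma cut_partialCleanUp_iff {early : Prop} {ω : Ω} (hω : π Label.z ω < r ↔ early) :
    Cut (partialCleanUp T B1 Bz) r (fun l => π l ω) ↔
      ω ∈ hitEvent (markEvent T B1 Bz r π early) [false] ∧
      ω ∈ hitEvent (markEvent T B1 Bz r π early) [true] := by
  rw [← forall_path_iff_mem_hitEvent]
  refine forall_congr' fun s => ?_
  constructor
  · intro hs
    by_cases hall : ∀ n, pathNode s n ∈ (partialCleanUp T B1 Bz).nodes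
    · obtain ⟨n, hn, hlt⟩ := hs hall
      exact ⟨n, hn, (mem_markEvent_iff hω _).2 fun _ => hlt⟩
    · push Not at hall
      obtain ⟨n, hn⟩ := hall
      refine ⟨n, Nat.one_le_iff_ne_zero.2 ?_, (mem_markEvent_iff hω _).2 fun h => absurd h hn⟩
      rintro rfl
      -- the root is never missing
      refine hn fun v _ b hb => ?_
      simpa [pathNode] using hb.length_le
  · rintro ⟨n, hn, hE⟩ hall
    exact ⟨n, hn, (mem_markEvent_iff hω _).1 hE (hall n)⟩

lemma cut_cleanUp_iff {ω : Ω} :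
    Cut cleanUp r (fun l => π l ω) ↔
      ω ∈ hitEvent (fun v => {ω | π (Label.fresh v) ω < r}) [false] ∧
      ω ∈ hitEvent (fun v => {ω | π (Label.fresh v) ω < r}) [true] := by
  rw [← forall_path_iff_mem_hitEvent]
  exact forall_congr' fun s => ⟨fun hs => hs fun _ => Set.mem_univ _, fun hs _ => hs⟩

lemma measurableSet_markEvent (early : Prop) (v : Node) :
    MeasurableSet[MeasurableSpace.comap (π (ownLabel B1 v)) inferInstance]
      (markEvent T B1 Bz r π early v) := by
  unfold markEvent
  split_ifs
  · exact @MeasurableSet.const _ (_) _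
  · exact ⟨Set.Iio r, measurableSet_Iio, rfl⟩
  · exact @MeasurableSet.univ _ (_)

variable [mΩ : MeasurableSpace Ω] {P : Measure Ω} [IsProbabilityMeasure P]

lemma measureReal_cut_cleanUp (hmeas : ∀ l, Measurable (π l)) (hind : iIndepFun π P) :
    P.real {ω | Cut cleanUp r (fun l => π l ω)} =
      hitProb (fun v => P.real {ω | π (Label.fresh v) ω < r}) [false] *
      hitProb (fun v => P.real {ω | π (Label.fresh v) ω < r}) [true] := by
  have hfresh : Function.Injective Label.fresh := fun u v h => by simpa using h
  have hind' := (hind.precomp hfresh).iIndep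
  have hm := fun v : Node => (hmeas (Label.fresh v)).comap_le
  have hE : ∀ v : Node, MeasurableSet[MeasurableSpace.comap (π (Label.fresh v)) inferInstance]
      {ω | π (Label.fresh v) ω < r} := fun v => ⟨Set.Iio r, measurableSet_Iio, rfl⟩
  refine Eq.trans ?_ (measureReal_hitEvent_children hm hind' hE [])
  congr 1
  ext ω
  exact cut_cleanUp_iff

/-- Conditioning on whether `z`, the label of the right child of the root, is placed early. -/
lemma measureReal_cut_partialCleanUp (hmeas : ∀ l, Measurable (π l)) (hind : iIndepFun π P)
    (hz : P.real {ω | π Label.z ω < r} = r) :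
    P.real {ω | Cut (partialCleanUp T B1 Bz) r (fun l => π l ω)} =
      r * (hitProb (fun v => P.real (markEvent T B1 Bz r π True v)) [false] *
        hitProb (fun v => P.real (markEvent T B1 Bz r π True v)) [true]) +
      (1 - r) * (hitProb (fun v => P.real (markEvent T B1 Bz r π False v)) [false] *
        hitProb (fun v => P.real (markEvent T B1 Bz r π False v)) [true]) := by
  have hind' := (hind.precomp (ownLabel_injective B1)).iIndep
  have hm := fun v : Node => (hmeas (ownLabel B1 v)).comap_le
  have hE := measurableSet_markEvent (T := T) (B1 := B1) (Bz := Bz) (r := r) (π := π)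
  have hZmeas : MeasurableSet {ω | π Label.z ω < r} := hmeas _ measurableSet_Iio
  have hZ : MeasurableSet[MeasurableSpace.comap (π Label.z) inferInstance]
      {ω | π Label.z ω < r} := ⟨Set.Iio r, measurableSet_Iio, rfl⟩
  -- the label `z` is independent of all other labels
  have hindz : Indep (MeasurableSpace.comap (π Label.z) inferInstance)
      (⨆ v, MeasurableSpace.comap (π (ownLabel B1 v)) inferInstance) P := by
    have h1 := indep_iSup_of_disjoint (fun l => (hmeas l).comap_le) hind.iIndep
      (S := {Label.z}) (T := Set.range (ownLabel B1))
      (Set.disjoint_left.2 fun l hl ⟨v, hv⟩ => ownLabel_ne_z B1 v (hv.trans hl))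
    rw [iSup_singleton, iSup_range] at h1
    exact h1
  set A : Prop → Set Ω := fun e => hitEvent (markEvent T B1 Bz r π e) [false] ∩
    hitEvent (markEvent T B1 Bz r π e) [true] with hA
  have hAm : ∀ e, MeasurableSet[⨆ v, MeasurableSpace.comap (π (ownLabel B1 v)) inferInstance]
      (A e) := fun e => by
    have hle : ∀ u : Node, (⨆ v ∈ {v : Node | u <+: v},
        MeasurableSpace.comap (π (ownLabel B1 v)) inferInstance) ≤
        ⨆ v, MeasurableSpace.comap (π (ownLabel B1 v)) inferInstance := fun u =>
      iSup₂_le_iSup _ _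
    exact @MeasurableSet.inter _ (_) _ _ (hle _ _ (measurableSet_hitEvent (hE e) _))
      (hle _ _ (measurableSet_hitEvent (hE e) _))
  have hAP : ∀ e, P.real (A e) = hitProb (fun v => P.real (markEvent T B1 Bz r π e v)) [false] *
      hitProb (fun v => P.real (markEvent T B1 Bz r π e v)) [true] := fun e =>
    measureReal_hitEvent_children hm hind' (hE e) []
  rw [← hAP, ← hAP, ← measureReal_inter_add_sdiff (μ := P)
    (s := {ω | Cut (partialCleanUp T B1 Bz) r _}) hZmeas]
  have hZ1 : P.real {ω | π Label.z ω < r}ᶜ = 1 - r := by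
    rw [measureReal_compl hZmeas, hz]; simp
  have e1 : {ω | Cut (partialCleanUp T B1 Bz) r (fun l => π l ω)} ∩ {ω | π Label.z ω < r} =
      {ω | π Label.z ω < r} ∩ A True := by
    ext ω
    simp only [Set.mem_inter_iff, Set.mem_ofPred_eq, hA]
    rw [and_comm]
    exact and_congr_right fun hω => cut_partialCleanUp_iff (iff_true_intro hω)
  have e0 : {ω | Cut (partialCleanUp T B1 Bz) r (fun l => π l ω)} \ {ω | π Label.z ω < r} =
      {ω | π Label.z ω < r}ᶜ ∩ A False := by
    ext ω
    simp only [Set.mem_sdiff, Set.mem_inter_iff, Set.mem_compl_iff, Set.mem_ofPred_eq, hA]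
    rw [and_comm]
    exact and_congr_right fun hω => cut_partialCleanUp_iff (iff_false_intro hω)
  rw [e1, e0, measureReal_inter_of_indep hindz hZ (hAm _),
    measureReal_inter_of_indep hindz (@MeasurableSet.compl _ _ (_) hZ) (hAm _), hz, hZ1]

end CutEvents

/-! ### The size of the corrections `δ` -/

lemma gamma_eq {r : ℝ} (hr : r < 1 / 2) : gamma r = r * (1 - 2 * r) ^ (3 / 2 : ℝ) := if_pos hr

lemma gamma_sq {r : ℝ} (hr : r < 1 / 2) : gamma r ^ 2 = r ^ 2 * (1 - 2 * r) ^ 3 := by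
  rw [gamma_eq hr, mul_pow, ← Real.rpow_natCast, ← Real.rpow_natCast,
    ← Real.rpow_mul (by linarith : 0 ≤ 1 - 2 * r), ← Real.rpow_natCast (1 - 2 * r)]
  norm_num

lemma phi_eq {r : ℝ} (hr : r < 1 / 2) :
    phi r = (1 - 2 * r) ^ (3 / 2 : ℝ) + r * (-3 * (1 - 2 * r) ^ (1 / 2 : ℝ)) := by
  have hpos : (0 : ℝ) < 1 - 2 * r := by linarith
  have h1 : HasDerivAt (fun s : ℝ => 1 - 2 * s) (-2) r := by
    simpa using ((hasDerivAt_id r).const_mul 2).const_sub 1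
  have h2 := h1.rpow_const (p := (3 / 2 : ℝ)) (Or.inl hpos.ne')
  have h3 := (hasDerivAt_id r).mul h2
  have heq : gamma =ᶠ[nhds r] fun s => s * (1 - 2 * s) ^ (3 / 2 : ℝ) := by
    filter_upwards [Iio_mem_nhds hr] with s hs
    exact gamma_eq hs
  rw [phi, heq.deriv_eq]
  refine (HasDerivAt.deriv h3).trans ?_
  norm_num

lemma gamma_mul_phi {r : ℝ} (hr : r < 1 / 2) :
    gamma r * phi r = r * (1 - 2 * r) ^ 2 * (1 - 5 * r) := by
  have hpos : (0 : ℝ) < 1 - 2 * r := by linarith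
  have e : (1 - 2 * r) ^ (3 / 2 : ℝ) = (1 - 2 * r) * (1 - 2 * r) ^ (1 / 2 : ℝ) := by
    rw [← Real.rpow_one_add' hpos.le (by norm_num)]
    norm_num
  have e2 : (1 - 2 * r) ^ (1 / 2 : ℝ) * (1 - 2 * r) ^ (1 / 2 : ℝ) = 1 - 2 * r := by
    rw [← Real.rpow_add hpos]; norm_num
  rw [gamma_eq hr, phi_eq hr, e]
  linear_combination r * (1 - 2 * r) * (1 - 5 * r) * e2

section DeltaMax

variable {ε r : ℝ}

lemma deltaRoot_nonneg : 0 ≤ deltaRoot ε r := le_max_left _ _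

lemma deltaNonRoot_nonneg (hε : 0 ≤ ε) (hr : r < 1 / 2) : 0 ≤ deltaNonRoot ε r := by
  have : 0 < 1 - r := by linarith
  unfold deltaNonRoot; positivity

lemma two_deltaNonRoot_le : 2 * deltaNonRoot ε r ≤ deltaMax ε r := by
  refine le_trans (le_of_eq ?_) (le_max_left _ _)
  unfold deltaNonRoot; ring

lemma deltaRoot_add_deltaNonRoot_le (hε : 0 ≤ ε) (hr : r < 1 / 2) :
    deltaRoot ε r + deltaNonRoot ε r ≤ deltaMax ε r := by
  have h0 := deltaNonRoot_nonneg hε hr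
  rw [deltaRoot, max_add]
  refine max_le (by linarith [two_deltaNonRoot_le (ε := ε) (r := r)]) ?_
  refine le_trans (le_of_eq ?_) (le_max_right _ _)
  unfold deltaNonRoot; ring

lemma deltaMax_nonneg (hε : 0 ≤ ε) (hr : r < 1 / 2) : 0 ≤ deltaMax ε r := by
  linarith [two_deltaNonRoot_le (ε := ε) (r := r), deltaNonRoot_nonneg hε hr]

/-- This makes the one-child bonus nonnegative. -/
lemma two_mul_deltaMax_le (hε0 : 0 ≤ ε) (hε1 : ε ≤ 1 / 10) (hr0 : 0 ≤ r) (hr : r < 1 / 2) :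
    2 * (1 - r) * deltaMax ε r ≤ r * (1 - 2 * r) := by
  have h1r : 0 < 1 - r := by linarith
  have hpos : 0 ≤ 1 - 2 * r := by linarith
  have hA : 0 ≤ r * (1 - 2 * r) := mul_nonneg hr0 hpos
  have h2 : (1 - 2 * r) ^ 2 ≤ 1 := by nlinarith
  unfold deltaMax
  rw [mul_max_of_nonneg _ _ (by linarith)]
  refine max_le ?_ ?_
  · have e : 2 * (1 - r) * (1.147 * ε * (2 * gamma r ^ 2 / (1 - r))) =
        (4.588 * ε) * (r * (1 - 2 * r) ^ 2) * (r * (1 - 2 * r)) := by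
      rw [gamma_sq hr]; field_simp; ring
    rw [e]
    have h3 : r * (1 - 2 * r) ^ 2 ≤ 1 := by nlinarith
    have h4 : (4.588 * ε) * (r * (1 - 2 * r) ^ 2) ≤ 1 := by
      have := mul_le_mul (by linarith : 4.588 * ε ≤ 1) h3 (by positivity) zero_le_one
      simpa using this
    simpa using mul_le_mul_of_nonneg_right h4 hA
  · have e : 2 * (1 - r) * (1.147 * ε * gamma r * (gamma r / (1 - r) - phi r)) =
        (2.294 * ε) * (r * (1 - 2 * r) ^ 2 - (1 - r) * (1 - 2 * r) * (1 - 5 * r)) *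
          (r * (1 - 2 * r)) := by
      have : 2 * (1 - r) * (1.147 * ε * gamma r * (gamma r / (1 - r) - phi r)) =
          2.294 * ε * (gamma r ^ 2 - (1 - r) * (gamma r * phi r)) := by
        field_simp; ring
      rw [this, gamma_sq hr, gamma_mul_phi hr]; ring
    rw [e]
    have h3 : r * (1 - 2 * r) ^ 2 - (1 - r) * (1 - 2 * r) * (1 - 5 * r) ≤ 4 := by
      have h5 : (1 - r) * (1 - 2 * r) ≤ 1 := by nlinarith
      have h6 : 0 ≤ (1 - r) * (1 - 2 * r) := mul_nonneg h1r.le hpos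
      have h7 : (1 - r) * (1 - 2 * r) * (5 * r - 1) ≤ 3 := by nlinarith
      nlinarith
    have h4 : (2.294 * ε) * (r * (1 - 2 * r) ^ 2 - (1 - r) * (1 - 2 * r) * (1 - 5 * r)) ≤ 1 := by
      nlinarith
    simpa using mul_le_mul_of_nonneg_right h4 hA

end DeltaMax

section Delta

variable {V : Type*} [DecidableEq V] {F : CNF V} {can : V → Clause V} {x : V} {h : ℕ}
  (T : CriticalClauseTree F can x h)

lemma CriticalClauseTree.isNode_of_append {v : Node} {b : Bool} (hv : T.IsNode (v ++ [b])) :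
    T.IsNode v ∧ v.length < h := by
  by_contra hc
  refine hv (T.no_children v b ?_)
  by_cases h1 : T.varLabel v = none
  · exact Or.inl h1
  · exact Or.inr (not_lt.1 fun h2 => hc ⟨h1, h2⟩)

/-- Distinct nodes on a path have distinct variables: a clause label is violated, so the variables
of its negative literals are set to `1`. -/
lemma CriticalClauseTree.varLabel_ne_of_prefix {u v : Node} {a : V} (huv : u <+: v) (hne : u ≠ v)
    (hu : T.varLabel u = some a) : T.varLabel v ≠ some a := by
  intro hv
  obtain ⟨w, b, rfl⟩ : ∃ w b, v = w ++ [b] := by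
    rcases List.eq_nil_or_concat v with rfl | ⟨w, b, rfl⟩
    · exact absurd (List.prefix_nil.1 huv) hne
    · exact ⟨w, b, by simp⟩
  have hnode : T.IsNode (w ++ [b]) := by simp [IsNode, hv]
  obtain ⟨hw, hlen⟩ := T.isNode_of_append hnode
  have huw : u <+: w := (List.prefix_concat_iff.1 huv).resolve_left hne
  have hlit := (T.children w hw hlen a).1 ⟨b, hv⟩
  exact (T.clauseLabel_mem w hw hlen).2 _ hlit ((T.assignment_eq w a).2 ⟨u, huw, hu⟩)

variable {TwoCC : Set V} {Hlow : SimpleGraph V} {ε r : ℝ}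

lemma delta_nonneg (hε : 0 ≤ ε) (hr : r < 1 / 2) (v : Node) : 0 ≤ delta T TwoCC Hlow ε r v := by
  refine Finset.sum_nonneg fun k _ => ?_
  split_ifs
  · exact deltaRoot_nonneg
  · exact deltaNonRoot_nonneg hε hr
  · exact le_rfl

/-- A node has at most two bosses, since their variables are distinct neighbours of its own
variable in `Hlow`. -/
lemma delta_le_deltaMax (hdeg : ∀ a, (Hlow.neighborSet a).encard ≤ 2) (hε : 0 ≤ ε)
    (hr : r < 1 / 2) (v : Node) : delta T TwoCC Hlow ε r v ≤ deltaMax ε r := by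
  classical
  unfold delta
  rw [← Finset.sum_filter]
  set K := (Finset.range v.length).filter fun k => T.IsSubordinate TwoCC Hlow v (v.take k) with hK
  have hroot := deltaRoot_nonneg (ε := ε) (r := r)
  have hnr := deltaNonRoot_nonneg hε hr
  have hcard : K.card ≤ 2 := by
    rcases K.eq_empty_or_nonempty with h0 | ⟨k₀, hk₀⟩
    · simp [h0]
    obtain ⟨-, -, -, -, b, -, hb, -⟩ := (Finset.mem_filter.1 hk₀).2
    have hlab : ∀ k ∈ K, ∃ a, T.varLabel (v.take k) = some a ∧ a ∈ Hlow.neighborSet b := by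
      intro k hk
      obtain ⟨-, -, -, a, b', ha, hb', hadj⟩ := (Finset.mem_filter.1 hk).2
      obtain rfl : b = b' := by simpa [hb] using hb'
      exact ⟨a, ha, hadj.symm⟩
    have : Nonempty V := ⟨b⟩
    choose! f hf using hlab
    have hinj : Set.InjOn f K := by
      intro k hk l hl hkl
      have hk' := Finset.mem_range.1 (Finset.mem_filter.1 hk).1
      have hl' := Finset.mem_range.1 (Finset.mem_filter.1 hl).1
      have aux : ∀ i j, i < j → j < v.length → i ∈ K → j ∈ K → f i ≠ f j := by
        intro i j hij hj hi hjK heq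
        refine T.varLabel_ne_of_prefix (List.take_prefix_take_left hij.le) ?_ (hf i hi).1
          (heq ▸ (hf j hjK).1)
        intro he
        have := congrArg List.length he
        simp only [List.length_take] at this
        omega
      rcases lt_trichotomy k l with hlt | heq | hlt
      · exact absurd hkl (aux k l hlt hl' hk hl)
      · exact heq
      · exact absurd hkl.symm (aux l k hlt hk' hl hk)
    have h1 : ((K.image f : Finset V) : Set V) ⊆ Hlow.neighborSet b := by
      intro a ha
      obtain ⟨k, hk, rfl⟩ := Finset.mem_image.1 (Finset.mem_coe.1 ha)
      exact (hf k hk).2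
    have h2 := (Set.encard_le_encard h1).trans (hdeg b)
    rw [Set.encard_coe_eq_coe_finsetCard, Finset.card_image_of_injOn hinj] at h2
    exact_mod_cast h2
  by_cases h0 : 0 ∈ K
  · rw [← Finset.add_sum_erase K _ h0, if_pos rfl]
    have hle : ∑ k ∈ K.erase 0, (if k = 0 then deltaRoot ε r else deltaNonRoot ε r) ≤
        deltaNonRoot ε r := by
      rw [Finset.sum_congr rfl fun k hk => if_neg (Finset.ne_of_mem_erase hk), Finset.sum_const,
        Finset.card_erase_of_mem h0, nsmul_eq_mul]
      have : ((K.card - 1 : ℕ) : ℝ) ≤ 1 := by exact_mod_cast (by omega : K.card - 1 ≤ 1)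
      nlinarith
    linarith [deltaRoot_add_deltaNonRoot_le hε hr]
  · have hne : ∀ k ∈ K, k ≠ 0 := fun k hk he => h0 (he ▸ hk)
    rw [Finset.sum_congr rfl fun k hk => if_neg (hne k hk), Finset.sum_const, nsmul_eq_mul]
    have : (K.card : ℝ) ≤ 2 := by exact_mod_cast hcard
    nlinarith [two_deltaNonRoot_le (ε := ε) (r := r)]

lemma delta_eq_zero_of_isolated {z : V} (hz : ∀ a, ¬ Hlow.Adj z a) {v : Node}
    (hv : T.varLabel v = some z) : delta T TwoCC Hlow ε r v = 0 := by
  classical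
  refine Finset.sum_eq_zero fun k _ => if_neg ?_
  rintro ⟨-, -, -, a, b, -, hb, hadj⟩
  obtain rfl : z = b := by simpa [hv] using hb
  exact hz a hadj.symm

end Delta

/-! ### The partially cleaned-up tree -/

section Final

variable {V : Type*} [DecidableEq V] {F : CNF V} {can : V → Clause V} {x : V} {h : ℕ}
  {T : CriticalClauseTree F can x h} {TwoCC : Set V} {z : V} {B1 Bz : Finset Node}

lemma mem_nodes_partialCleanUp {v : Node} (hv : ∀ u ∈ B1, u <+: v → u = v) :
    v ∈ (partialCleanUp T B1 Bz).nodes := by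
  intro u hu b hb
  have huv := hv u hu (prefix_of_append_prefix hb)
  have := child_prefix_length hb
  rw [huv] at this
  omega

lemma IsHarvest.isHarvestProb (hB : IsHarvest T TwoCC z B1 Bz) {Hlow : SimpleGraph V}
    (hdeg : ∀ a, (Hlow.neighborSet a).encard ≤ 2) (hz : ∀ a, ¬ Hlow.Adj z a)
    (hR : T.varLabel [true] = some z) {ε r : ℝ} (hε0 : 0 ≤ ε) (hr1 : r < 1 / 2)
    (hs1 : r - deltaMax ε r ≤ 1)
    {Ω : Type*} [MeasurableSpace Ω] {P : Measure Ω} [IsProbabilityMeasure P] {π : Label → Ω → ℝ}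
    (hπ : IsCleanPlacement P r (delta T TwoCC Hlow ε r) (deltaMax ε r) π) :
    IsHarvestProb r (r - deltaMax ε r) B1 Bz
      (fun v => P.real {ω | π (Label.fresh v) ω < r})
      (fun v => P.real (markEvent T B1 Bz r π False v))
      (fun v => P.real (markEvent T B1 Bz r π True v)) where
  pF_mem v := by
    rw [hπ.prob_fresh]
    have h0 := delta_nonneg T (TwoCC := TwoCC) (Hlow := Hlow) hε0 hr1 v
    have h1 := delta_le_deltaMax T (TwoCC := TwoCC) hdeg hε0 hr1 v
    constructor <;> linarith
  p0_mem v := ⟨measureReal_nonneg, measureReal_le_one⟩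
  p1_mem v := ⟨measureReal_nonneg, measureReal_le_one⟩
  antichain := hB.antichain
  disjoint := hB.disjoint
  left := hB.left
  unchanged v hvz hvR hv1 := by
    have hn : v ∈ (partialCleanUp T B1 Bz).nodes :=
      mem_nodes_partialCleanUp fun u hu huv => absurd huv (hv1 u hu)
    have hown : ownLabel B1 v = Label.fresh v := if_neg fun ⟨u, hu, huv⟩ => hv1 u hu huv
    simp only [markEvent, if_pos hn, if_neg (not_or.2 ⟨hvz, hvR⟩), hown, and_self]
  z_nodes v hv := by
    have hlabel : T.varLabel v = some z := by
      rcases hv with hv | rfl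
      · exact hB.label_Bz v hv
      · exact hR
    have hn : v ∈ (partialCleanUp T B1 Bz).nodes := mem_nodes_partialCleanUp fun u hu huv => by
      rcases hv with hv | rfl
      · exact hB.antichain u (by simp [hu]) v (by simp [hv]) huv
      · exact absurd (not_left_of_right ((hB.left u (by simp [hu])).trans huv) List.prefix_rfl) id
    refine ⟨?_, ?_, ?_⟩
    · rw [hπ.prob_fresh, delta_eq_zero_of_isolated T hz hlabel, sub_zero]
    · simp [markEvent, hn, hv]
    · simp [markEvent, hn, hv]
  below b hb v hbv := by
    have hvz : ¬ (v ∈ Bz ∨ v = [true]) := by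
      rintro (hv | rfl)
      · have := hB.antichain b (by simp [hb]) v (by simp [hv]) hbv
        exact Finset.disjoint_left.1 hB.disjoint hb (this ▸ hv)
      · exact not_left_of_right ((hB.left b (by simp [hb])).trans hbv) List.prefix_rfl
    have hown : ownLabel B1 v = Label.below v := if_pos ⟨b, hb, hbv⟩
    simp only [markEvent, if_neg hvz, hown, true_and]
    split_ifs
    · exact hπ.prob_below v
    · simpa using hs1
  missing b hb := by
    obtain ⟨c, hc⟩ : ∃ c, ¬ T.IsNode (b ++ [c]) := by
      by_contra! hall
      exact hB.oneChild b hb ⟨hall false, hall true⟩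
    have hn : b ++ [c] ∉ (partialCleanUp T B1 Bz).nodes := fun hmem =>
      hc (hmem b hb c List.prefix_rfl)
    exact ⟨c, by simp [markEvent, hn]⟩

/-- The left child of the root has depth `1`, whence the shift of the exponent. -/
lemma bonus_left {B : Finset Node} (hB : ∀ v ∈ B, [false] <+: v) (c κ : ℝ) :
    bonus B c κ [false] = ∑ v ∈ B, c * κ ^ (v.length - 1) := by
  classical
  rw [bonus, Finset.filter_true_of_mem hB]
  rfl

end Final

end PPSZ

theorem mainTheorem7 {V : Type*} [Fintype V] [DecidableEq V]
    (F : PPSZ.CNF V) (hF3 : PPSZ.IsThreeCNF F) (hF1 : PPSZ.UniquelySatisfiedByOnes F)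
    (can : V → PPSZ.Clause V) (hcan : PPSZ.IsCanonicalChoice F can)
    -- the variables with several critical clauses
    (TwoCC : Set V)
    (hTwoCC : ∀ a C C', PPSZ.IsCritical F a C → PPSZ.IsCritical F a C' → C ≠ C' → a ∈ TwoCC)
    -- the graph of correlated pairs
    (Hlow : SimpleGraph V) (hH : Hlow ≤ PPSZ.pairGraph can)
    (hdeg : ∀ a, (Hlow.neighborSet a).encard ≤ 2)
    -- the variable `x` with its canonical critical clause, and its tree
    (x y z : V) (hx : x ∉ TwoCC) (hyz : y ≠ z)
    (hxyz : can x = {(x, true), (y, false), (z, false)})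
    (hz : ∀ a, ¬ Hlow.Adj z a)
    (h : ℕ) (T : PPSZ.CriticalClauseTree F can x h)
    (hL : T.varLabel [false] = some y) (hR : T.varLabel [true] = some z)
    (B1 Bz : Finset PPSZ.Node) (hB : PPSZ.IsHarvest T TwoCC z B1 Bz)
    (ε r : ℝ) (hε0 : 0 ≤ ε) (hε1 : ε ≤ 1 / 10) (hr0 : 0 ≤ r) (hr1 : r < 1 / 2)
    {Ω : Type*} [MeasurableSpace Ω] (P : MeasureTheory.Measure Ω)
    [MeasureTheory.IsProbabilityMeasure P] (π : PPSZ.Label → Ω → ℝ)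
    (hπ : PPSZ.IsCleanPlacement P r (PPSZ.delta T TwoCC Hlow ε r) (PPSZ.deltaMax ε r) π) :
    P.real {ω | PPSZ.Cut (PPSZ.partialCleanUp T B1 Bz) r (fun l => π l ω)} ≥
      P.real {ω | PPSZ.Cut PPSZ.cleanUp r (fun l => π l ω)}
        + ∑ v ∈ B1, PPSZ.OCB ε v.length r + ∑ v ∈ Bz, PPSZ.MLB ε v.length r := by
  have hd0 := PPSZ.deltaMax_nonneg hε0 hr1
  have hd := PPSZ.two_mul_deltaMax_le hε0 hε1 hr0 hr1
  have H := hB.isHarvestProb hdeg hz hR hε0 hr1 (by linarith) hπ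
  rw [PPSZ.measureReal_cut_cleanUp hπ.measurable hπ.indep,
    PPSZ.measureReal_cut_partialCleanUp hπ.measurable hπ.indep hπ.prob_z]
  have hright := PPSZ.hitProb_of_eq_one H.p1_mem (H.z_nodes [true] (Or.inr rfl)).2.2
  have hleft1 : ∀ v ∈ B1, [false] <+: v := fun v hv => hB.left v (by simp [hv])
  have hleftz : ∀ v ∈ Bz, [false] <+: v := fun v hv => hB.left v (by simp [hv])
  rw [hright, mul_one]
  set d := PPSZ.deltaMax ε r with hd_def
  have hr : 0 < 1 - r := by linarith
  have hdr : d ≤ r * (1 - r) := by nlinarith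
  have hdr' : d ≤ r := by nlinarith
  have hs : 0 < 1 - (r - d) := by linarith
  have hmain := H.cut_inequality (κ := r - d / (1 - r)) (by linarith) (by linarith) hr1
    (by rw [sub_nonneg, div_le_iff₀ hr]; exact hdr)
    -- `κ / (1 - r)` is the value at `s = r - d` of the tangent at `r` to the convex function
    -- `t / (1 - t)`
    (by
      rw [mul_div_assoc', le_div_iff₀ hs, sub_mul, div_mul_eq_mul_div, sub_le_iff_le_add,
        ← sub_le_iff_le_add', le_div_iff₀ hr]
      nlinarith [sq_nonneg d])
    (by
      rw [sub_nonneg, div_le_iff₀ hr]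
      linarith)
  rw [PPSZ.bonus_left hleft1, PPSZ.bonus_left hleftz, Finset.sum_mul, Finset.sum_mul] at hmain
  have hO : ∑ v ∈ B1, PPSZ.OCB ε v.length r = ∑ v ∈ B1, (2 * (r - d) - r / (1 - r)) *
      (r - d / (1 - r)) ^ (v.length - 1) * ((r - d / (1 - r)) / (1 - r)) := by
    refine Finset.sum_congr rfl fun v hv => ?_
    obtain ⟨k, hk⟩ : ∃ k, v.length = k + 1 :=
      ⟨v.length - 1, by have := (hleft1 v hv).length_le; simp at this; omega⟩
    rw [PPSZ.OCB, if_pos hr1, ← hd_def, hk, Nat.add_sub_cancel, pow_succ]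
    generalize r - d / (1 - r) = κ
    field_simp
    ring
  have hM : ∑ v ∈ Bz, PPSZ.MLB ε v.length r = ∑ v ∈ Bz, (1 - (r / (1 - r)) ^ 2) *
      (r - d / (1 - r)) ^ (v.length - 1) * (r * (1 - r) * (1 - (r / (1 - r)) ^ 2)) := by
    refine Finset.sum_congr rfl fun v _ => ?_
    rw [PPSZ.MLB, PPSZ.Q, if_pos hr1, if_pos hr1, ← hd_def]
    ring
  rw [hO, hM]
  exact hmain
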